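/- A Cantor space is a non-empty, zero-dimensional, compact, perfect metrizable space $X$. A homeomorphism $T$ of $X$ is aperiodic if it has no periodic points, i.e. $T^n x \neq x$ for all $x\in X$ and $n\ge 1$. For a Borel measure $\mu$ on $X$ let $\mathfrak{M}_\mu=\{x\in X:\ \mu(U)=\infty \text{ for every clopen } U\ni x\}$. Call $\mu$ non-defective if $\mu(X)=\infty$, every non-empty open set has positive measure, every point has measure zero, and $\mu(\mathfrak{M}_\mu)=0$. Call $\mu$ good if for all clopen sets $U,V\subseteq X$ with $\mu(U)<\mu(V)$ there is a clopen set $W\subseteq V$ with $\mu(W)=\mu(U)$. Let $S(\mu)=\{\mu(U):\ U\subseteq X \text{ clopen},\ \mu(U)<\infty\}$. A set $D\subseteq[0,\infty)$ is group-like if for every $\gamma\in D$ there is an additive subgroup $G$ of $\mathbb{R}$ with $D\cap[0,\gamma]=G\cap[0,\gamma]$. Corollary. Let $D$ be a countable group-like subset of $[0,\infty)$ which is dense in $[0,\infty)$. Then there exist a Cantor space $X$, an aperiodic homeomorphism $T\colon X\to X$ and a good non-defective Borel measure $\widetilde\mu$ on $X$ which is invariant under $T$ and satisfies $S(\widetilde\mu)=D$.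 -/

import Mathlib

open Set MeasureTheory

/-- A Cantor space: a non-empty zero-dimensional compact perfect metrizable space. -/
structure IsCantorSpace (X : Type*) [TopologicalSpace X] : Prop where
  nonempty : Nonempty X
  compact : CompactSpace X
  metrizable : TopologicalSpace.MetrizableSpace X
  perfect : PerfectSpace X
  zeroDimensional : TopologicalSpace.IsTopologicalBasis {U : Set X | IsClopen U}

/-- A subset `D` of `[0, ∞)` is group-like if for every `γ ∈ D` there is an additive subgroup
`G` of `ℝ` with `D ∩ [0, γ] = G ∩ [0, γ]`. -/
def IsGroupLike (D : Set ℝ) : Prop :=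
  D ⊆ Ici 0 ∧ ∀ γ ∈ D, ∃ G : AddSubgroup ℝ, D ∩ Icc 0 γ = (G : Set ℝ) ∩ Icc 0 γ

section Measures

variable {X : Type*} [TopologicalSpace X] [MeasurableSpace X]

/-- The defective set of `μ`: the points all of whose clopen neighbourhoods have infinite
measure. -/
def defectiveSet (μ : Measure X) : Set X :=
  {x | ∀ U : Set X, IsClopen U → x ∈ U → μ U = ⊤}

/-- A non-defective measure: an infinite, full (positive on non-empty open sets), non-atomic
measure whose defective set is null. It is meant for Borel measures on a Cantor space. -/
structure IsNonDefective (μ : Measure X) : Prop where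
  full : ∀ U : Set X, IsOpen U → U.Nonempty → 0 < μ U
  nonatomic : ∀ x : X, μ {x} = 0
  infinite : μ univ = ⊤
  null_defectiveSet : μ (defectiveSet μ) = 0

/-- A set `V` is good for `μ` if for every clopen `U` with `μ U < μ V` there is a clopen
`W ⊆ V` with `μ W = μ U`. -/
def IsGoodSet (μ : Measure X) (V : Set X) : Prop :=
  ∀ U : Set X, IsClopen U → μ U < μ V → ∃ W : Set X, IsClopen W ∧ W ⊆ V ∧ μ W = μ U

/-- A measure is good if every clopen set is good for it. -/
def IsGoodMeasure (μ : Measure X) : Prop :=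
  ∀ V : Set X, IsClopen V → IsGoodSet μ V

/-- The clopen values set: the finite values of `μ` on clopen sets, as real numbers. -/
def clopenValues (μ : Measure X) : Set ℝ :=
  {r | ∃ U : Set X, IsClopen U ∧ μ U < ⊤ ∧ (μ U).toReal = r}

end Measures

/-- A homeomorphism is aperiodic if it has no periodic points. -/
def IsAperiodic {X : Type*} [TopologicalSpace X] (T : X ≃ₜ X) : Prop :=
  ∀ (x : X) (n : ℕ), 0 < n → T^[n] x ≠ x

/-! ### Group-like sets -/

/-! Density makes `D` unbounded, so the local subgroups glue and `D` is the non-negative part of a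
countable dense subgroup `G` (`IsGroupLike.exists_addSubgroup`). Fix `0 < γ` in `G` and split the
points of `[0, γ)` lying in `G`. The resulting space of cuts `K` is compact, metrizable because `G`
is countable, and its clopen sets are finite unions of half-open intervals with ends in `G`.
Lebesgue measure thus takes values in `G` on them, and every smaller non-negative element of `G` is
attained inside (`isDivisibleSet_cutMeasure`). To make the measure infinite, take the product of `K`
with a compactification of `ℤ` carrying counting measure. Translation of `ℤ` preserves the measure.
In the one-point compactification it would fix infinity, so `ℤ_[2]` is glued on instead, where
adding `1` has no periodic points. The added part is null, and a clopen set meeting it has infinite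
measure, so finite clopen values come from finitely many copies of `K`
(`exists_subset_integerPart`). -/

lemma exists_mem_Ioo_of_Ici_subset_closure {D : Set ℝ} (hdense : Ici (0 : ℝ) ⊆ closure D)
    {a b : ℝ} (ha : 0 ≤ a) (hab : a < b) : ∃ g ∈ D, g ∈ Ioo a b := by
  have hmem : (a + b) / 2 ∈ closure D := hdense (mem_Ici.2 (by linarith))
  obtain ⟨g, hg, hgD⟩ := mem_closure_iff.1 hmem (Ioo a b) isOpen_Ioo
    ⟨by linarith, by linarith⟩
  exact ⟨g, hgD, hg⟩

/-- An unbounded group-like set is the non-negative part of a subgroup of `ℝ`. -/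
lemma IsGroupLike.exists_addSubgroup {D : Set ℝ} (hgroup : IsGroupLike D)
    (hunbounded : ∀ a : ℝ, ∃ γ ∈ D, a < γ) :
    ∃ G : AddSubgroup ℝ, D = {x | x ∈ G ∧ 0 ≤ x} := by
  -- One subgroup describes `D`, up to sign, on all of `[-a, a]`; closure under addition only needs
  -- `a = |x| + |y|`.
  have key : ∀ a : ℝ, ∃ H : AddSubgroup ℝ, ∀ x, |x| ≤ a → (|x| ∈ D ↔ x ∈ H) := by
    intro a
    obtain ⟨γ, hγ, haγ⟩ := hunbounded a
    obtain ⟨H, hH⟩ := hgroup.2 γ hγ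
    refine ⟨H, fun x hx => ?_⟩
    have hmem : |x| ∈ Icc 0 γ := ⟨abs_nonneg x, by linarith⟩
    have := Set.ext_iff.1 hH |x|
    simp only [mem_inter_iff, hmem, and_true, SetLike.mem_coe] at this
    rw [this]
    rcases abs_choice x with h | h <;> simp [h]
  refine ⟨{ carrier := {x | |x| ∈ D}, zero_mem' := ?_, add_mem' := ?_, neg_mem' := ?_ }, ?_⟩
  · intro x y hx hy
    obtain ⟨H, hH⟩ := key (|x| + |y|)
    exact (hH _ (abs_add_le x y)).2 (H.add_mem ((hH x (by linarith [abs_nonneg y])).1 hx)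
      ((hH y (by linarith [abs_nonneg x])).1 hy))
  · obtain ⟨H, hH⟩ := key 0
    exact (hH 0 (by simp)).2 H.zero_mem
  · intro x hx
    simpa using hx
  · ext x
    constructor
    · intro hx
      have h0 : 0 ≤ x := hgroup.1 hx
      exact ⟨by change |x| ∈ D; rwa [abs_of_nonneg h0], h0⟩
    · rintro ⟨hx, h0⟩
      change |x| ∈ D at hx
      rwa [abs_of_nonneg h0] at hx

/-! ### Divisible sets -/

section Divisible

variable {X : Type*} [TopologicalSpace X] [MeasurableSpace X]

/-- A set `V` is divisible over `G` if its measure is in `G` and all smaller non-negative elements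
of `G` are measures of clopen subsets of `V`. -/
def IsDivisibleSet (μ : Measure X) (G : AddSubgroup ℝ) (V : Set X) : Prop :=
  ∃ e ∈ G, 0 ≤ e ∧ μ V = ENNReal.ofReal e ∧
    ∀ d ∈ G, 0 ≤ d → d ≤ e → ∃ W ⊆ V, IsClopen W ∧ μ W = ENNReal.ofReal d

lemma isDivisibleSet_empty (μ : Measure X) (G : AddSubgroup ℝ) : IsDivisibleSet μ G ∅ :=
  ⟨0, G.zero_mem, le_rfl, by simp, fun d _ h0 h1 =>
    ⟨∅, subset_rfl, isClopen_empty, by simp [le_antisymm h1 h0]⟩⟩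

/-- Fill `A` first; once `d` exceeds its measure, take all of `A` and find the remainder in `B`. -/
lemma IsDivisibleSet.union [OpensMeasurableSpace X] {μ : Measure X} {G : AddSubgroup ℝ}
    {A B : Set X} (hA : IsDivisibleSet μ G A) (hB : IsDivisibleSet μ G B) (hAc : IsClopen A)
    (hAB : Disjoint A B) : IsDivisibleSet μ G (A ∪ B) := by
  obtain ⟨a, haG, ha0, hμA, hA⟩ := hA
  obtain ⟨b, hbG, hb0, hμB, hB⟩ := hB
  refine ⟨a + b, G.add_mem haG hbG, by positivity, ?_, fun d hd hd0 hdab => ?_⟩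
  · rw [measure_union' hAB hAc.isOpen.measurableSet, hμA, hμB, ENNReal.ofReal_add ha0 hb0]
  · rcases le_total d a with h | h
    · obtain ⟨W, hW, hWc, hμW⟩ := hA d hd hd0 h
      exact ⟨W, hW.trans subset_union_left, hWc, hμW⟩
    · obtain ⟨W, hW, hWc, hμW⟩ := hB (d - a) (G.sub_mem hd haG) (by linarith) (by linarith)
      refine ⟨A ∪ W, union_subset_union_right A hW, hAc.union hWc, ?_⟩
      rw [measure_union' (hAB.mono_right hW) hAc.isOpen.measurableSet, hμA, hμW,
        ← ENNReal.ofReal_add ha0 (by linarith)]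
      congr 1
      ring

/-- A full non-atomic measure lives on a space without isolated points. -/
lemma perfectSpace_of_full_of_nonatomic {μ : Measure X}
    (hfull : ∀ U : Set X, IsOpen U → U.Nonempty → 0 < μ U) (hna : ∀ x : X, μ {x} = 0) :
    PerfectSpace X := by
  refine perfectSpace_iff_forall_not_isolated.2 fun x => ?_
  by_contra h
  rw [Filter.not_neBot, ← isOpen_singleton_iff_punctured_nhds] at h
  exact (hfull {x} h (singleton_nonempty x)).ne' (hna x)

end Divisible

/-! ### The interval cut along a subgroup -/

section Cut

variable {G : AddSubgroup ℝ}

/-- The cuts of `G` between `0` and `γ`. -/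
def cutSet (γ : G) : Set (G → Bool) :=
  {f | Antitone f ∧ f 0 = true ∧ f γ = false}

lemma isClosed_cutSet (γ : G) : IsClosed (cutSet γ) := by
  have h1 : IsClosed {f : G → Bool | Antitone f} := by
    have : {f : G → Bool | Antitone f} = ⋂ (a : G) (b : G) (_ : a ≤ b), {f | f b ≤ f a} := by
      ext f; simp [Antitone]
    rw [this]
    refine isClosed_iInter fun a => isClosed_iInter fun b => isClosed_iInter fun _ => ?_
    have hc : Continuous fun f : G → Bool => (f b, f a) := by fun_prop
    exact (isClopen_discrete {p : Bool × Bool | p.1 ≤ p.2}).isClosed.preimage hc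
  exact h1.inter ((isClosed_eq (continuous_apply 0) continuous_const).inter
    (isClosed_eq (continuous_apply γ) continuous_const))

instance (γ : G) : CompactSpace (cutSet γ) :=
  isCompact_iff_compactSpace.1 (isClosed_cutSet γ).isCompact

/-- The half-open interval from `a` to `b` in the space of cuts. -/
def cutIco (γ a b : G) : Set (cutSet γ) := {f | f.1 a = true ∧ f.1 b = false}

lemma isClopen_cutIco (γ a b : G) : IsClopen (cutIco γ a b) := by
  have h : ∀ (c : G) (v : Bool), IsClopen {f : cutSet γ | f.1 c = v} := fun c v =>
    (isClopen_discrete {v}).preimage ((continuous_apply c).comp continuous_subtype_val)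
  exact (h a true).inter (h b false)

lemma mem_of_le {γ a b : G} (f : cutSet γ) (hab : a ≤ b) (hb : f.1 b = true) :
    f.1 a = true := by
  have := f.2.1 hab
  rw [hb] at this
  exact top_le_iff.1 this

lemma notMem_of_le {γ a b : G} (f : cutSet γ) (hab : a ≤ b) (ha : f.1 a = false) :
    f.1 b = false := by
  have := f.2.1 hab
  rw [ha] at this
  exact le_bot_iff.1 this

lemma lt_of_mem_of_notMem {γ a b : G} (f : cutSet γ) (ha : f.1 a = true) (hb : f.1 b = false) :
    a < b := by
  by_contra h
  rw [mem_of_le f (not_lt.1 h) ha] at hb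
  exact absurd hb (by simp)

/-- Every neighbourhood of a cut contains a half-open interval around it. -/
lemma exists_cutIco_subset {γ : G} {U : Set (cutSet γ)} (hU : IsOpen U) {f : cutSet γ}
    (hf : f ∈ U) : ∃ a b : G, 0 ≤ a ∧ a < b ∧ b ≤ γ ∧ f ∈ cutIco γ a b ∧ cutIco γ a b ⊆ U := by
  obtain ⟨V, hV, rfl⟩ := isOpen_induced_iff.1 hU
  obtain ⟨I, u, hu, hIV⟩ := isOpen_pi_iff.1 hV f.1 hf
  -- A basic neighbourhood constrains finitely many coordinates. By monotonicity, the value at `c`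
  -- is forced by raising the left end to `c` or lowering the right end to `c`.
  have key : ∀ J : Finset G, ∃ a b : G, 0 ≤ a ∧ b ≤ γ ∧ f ∈ cutIco γ a b ∧
      ∀ g ∈ cutIco γ a b, ∀ c ∈ J, g.1 c = f.1 c := by
    intro J
    induction J using Finset.induction_on with
    | empty => exact ⟨0, γ, le_rfl, le_rfl, ⟨f.2.2.1, f.2.2.2⟩, by simp⟩
    | insert c J _ ih =>
      obtain ⟨a, b, ha, hb, hfab, h⟩ := ih
      cases hc : f.1 c with
      | true =>
        refine ⟨max a c, b, ha.trans (le_max_left _ _), hb, ⟨?_, hfab.2⟩, fun g hg d hd => ?_⟩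
        · rcases max_choice a c with h' | h' <;> rw [h']
          exacts [hfab.1, hc]
        · rcases Finset.mem_insert.1 hd with rfl | hd
          · rw [hc, mem_of_le g (le_max_right a d) hg.1]
          · exact h g ⟨mem_of_le g (le_max_left a c) hg.1, hg.2⟩ d hd
      | false =>
        refine ⟨a, min b c, ha, (min_le_left _ _).trans hb, ⟨hfab.1, ?_⟩, fun g hg d hd => ?_⟩
        · rcases min_choice b c with h' | h' <;> rw [h']
          exacts [hfab.2, hc]
        · rcases Finset.mem_insert.1 hd with rfl | hd
          · rw [hc, notMem_of_le g (min_le_right b d) hg.2]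
          · exact h g ⟨hg.1, notMem_of_le g (min_le_left b c) hg.2⟩ d hd
  obtain ⟨a, b, ha, hb, hfab, h⟩ := key I
  refine ⟨a, b, ha, lt_of_mem_of_notMem f hfab.1 hfab.2, hb, hfab, fun g hg => hIV fun c hc => ?_⟩
  rw [h g hg c hc]
  exact (hu c hc).2

open Classical in
/-- The cut determined by a real number of `[0, γ)`. -/
noncomputable def cutOf (γ : G) (t : Ico (0 : ℝ) γ) : cutSet γ :=
  ⟨fun g => decide ((g : ℝ) ≤ t), by
    refine ⟨fun a b hab => ?_, by simpa using t.2.1, by simpa using t.2.2⟩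
    rw [Bool.le_iff_imp]
    simpa using fun h => le_trans (Subtype.coe_le_coe.2 hab) h⟩

lemma cutOf_mem_cutIco {γ a b : G} {t : Ico (0 : ℝ) γ} :
    cutOf γ t ∈ cutIco γ a b ↔ (t : ℝ) ∈ Ico (a : ℝ) b := by
  simp [cutOf, cutIco]

lemma cutIco_zero_self (γ : G) : cutIco γ 0 γ = univ := by
  ext f
  simp [cutIco, f.2.2.1, f.2.2.2]

/-- Every cut is true at `0` and false at `γ`, so ends outside `[0, γ]` can be moved to where the
length formula is valid. -/
lemma cutIco_eq_clamp (γ a b : G) : cutIco γ a b = cutIco γ (max a 0) (min b γ) := by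
  ext f
  constructor
  · rintro ⟨h1, h2⟩
    refine ⟨?_, ?_⟩
    · rcases max_choice a 0 with h | h <;> rw [h]
      exacts [h1, f.2.2.1]
    · rcases min_choice b γ with h | h <;> rw [h]
      exacts [h2, f.2.2.2]
  · rintro ⟨h1, h2⟩
    exact ⟨mem_of_le f (le_max_left _ _) h1, notMem_of_le f (min_le_left _ _) h2⟩

lemma measurable_cutOf (γ : G) : Measurable (cutOf γ) := by
  refine Measurable.subtype_mk (measurable_pi_lambda _ fun g => ?_)
  refine measurable_to_bool ?_
  have hm : MeasurableSet {t : Ico (0 : ℝ) γ | (g : ℝ) ≤ t} :=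
    measurableSet_le measurable_const measurable_subtype_coe
  convert hm using 1
  ext t
  simp

/-- The Lebesgue measure on the space of cuts. -/
noncomputable def cutMeasure (γ : G) : Measure (cutSet γ) :=
  (volume.comap ((↑) : Ico (0 : ℝ) γ → ℝ)).map (cutOf γ)

lemma cutMeasure_apply {γ : G} {V : Set (cutSet γ)} (hV : MeasurableSet V) :
    cutMeasure γ V = volume ((↑) '' (cutOf γ ⁻¹' V) : Set ℝ) := by
  rw [cutMeasure, Measure.map_apply (measurable_cutOf γ) hV,
    (MeasurableEmbedding.subtype_coe measurableSet_Ico).comap_apply]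

variable [Countable G]

lemma cutMeasure_cutIco {γ a b : G} (ha : 0 ≤ a) (hb : b ≤ γ) :
    cutMeasure γ (cutIco γ a b) = ENNReal.ofReal (b - a) := by
  rw [cutMeasure_apply (isClopen_cutIco γ a b).isOpen.measurableSet, ← Real.volume_Ico]
  congr 1
  ext t
  simp only [mem_image, mem_preimage, cutOf_mem_cutIco, Subtype.exists, exists_and_right,
    exists_eq_right]
  constructor
  · rintro ⟨_, h⟩
    exact h
  · intro h
    exact ⟨⟨(show (0 : ℝ) ≤ a from ha).trans h.1, h.2.trans_le hb⟩, h⟩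

lemma cutMeasure_univ (γ : G) : cutMeasure γ univ = ENNReal.ofReal γ := by
  rw [← cutIco_zero_self, cutMeasure_cutIco le_rfl le_rfl]
  simp

lemma cutMeasure_pos {γ : G} {U : Set (cutSet γ)} (hU : IsOpen U) (hne : U.Nonempty) :
    0 < cutMeasure γ U := by
  obtain ⟨f, hf⟩ := hne
  obtain ⟨a, b, ha, hab, hb, -, h⟩ := exists_cutIco_subset hU hf
  refine lt_of_lt_of_le ?_ (measure_mono h)
  rw [cutMeasure_cutIco ha hb, ENNReal.ofReal_pos]
  exact sub_pos.2 hab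

/-- By density an element of `G` separates any two reals, so at most one real determines a given
cut. -/
lemma cutMeasure_singleton (hG : ∀ a b : ℝ, 0 ≤ a → a < b → ∃ g ∈ G, g ∈ Ioo a b) {γ : G}
    (f : cutSet γ) : cutMeasure γ {f} = 0 := by
  rw [cutMeasure_apply (measurableSet_singleton f)]
  have key : ∀ s t : Ico (0 : ℝ) γ, (s : ℝ) < t → cutOf γ s ≠ cutOf γ t := by
    intro s t hst heq
    obtain ⟨g, hg, hsg, hgt⟩ := hG s t s.2.1 hst
    have := congrFun (congrArg Subtype.val heq) ⟨g, hg⟩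
    simp [cutOf, hgt.le, hsg.not_ge] at this
  refine Set.Subsingleton.measure_zero ?_ _
  rintro _ ⟨s, hs, rfl⟩ _ ⟨t, ht, rfl⟩
  have heq : cutOf γ s = cutOf γ t := by
    rw [mem_preimage, mem_singleton_iff] at hs ht
    rw [hs, ht]
  rcases lt_trichotomy (s : ℝ) t with h | h | h
  exacts [absurd heq (key s t h), h, absurd heq.symm (key t s h)]

/-- The initial segment from `a` to `a + d` has measure `d`. -/
lemma isDivisibleSet_cutIco (γ a b : G) : IsDivisibleSet (cutMeasure γ) G (cutIco γ a b) := by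
  rw [cutIco_eq_clamp]
  have ha : 0 ≤ max a 0 := le_max_right _ _
  have hb : min b γ ≤ γ := min_le_right _ _
  generalize max a 0 = a at *
  generalize min b γ = b at *
  rcases le_total a b with hab | hab
  · refine ⟨b - a, (b - a).2, sub_nonneg.2 hab, cutMeasure_cutIco ha hb, fun d hd hd0 hdab => ?_⟩
    have hle : a + ⟨d, hd⟩ ≤ b := by
      rw [← Subtype.coe_le_coe]
      push_cast
      linarith
    refine ⟨cutIco γ a (a + ⟨d, hd⟩), fun f hf => ⟨hf.1, notMem_of_le f hle hf.2⟩,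
      isClopen_cutIco _ _ _, ?_⟩
    rw [cutMeasure_cutIco ha (hle.trans hb)]
    simp
  · have : cutIco γ a b = ∅ := by
      ext f
      simpa [cutIco] using fun h => mem_of_le f hab h
    rw [this]
    exact isDivisibleSet_empty _ _

open Classical in
lemma isDivisibleSet_cutMeasure {γ : G} {V : Set (cutSet γ)} (hV : IsClopen V) :
    IsDivisibleSet (cutMeasure γ) G V := by
  -- The covering intervals may overlap. Controlling the trace on every interval makes the induction
  -- on their number work.
  suffices h : IsClopen V ∧ ∀ c d : G, IsDivisibleSet (cutMeasure γ) G (V ∩ cutIco γ c d) by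
    simpa [cutIco_zero_self] using h.2 0 γ
  have hcover : ∀ f : cutSet γ, ∃ p : G × G, p.1 < p.2 ∧
      (f ∈ V → f ∈ cutIco γ p.1 p.2 ∧ cutIco γ p.1 p.2 ⊆ V) := by
    intro f
    by_cases hf : f ∈ V
    · obtain ⟨a, b, -, hab, -, h1, h2⟩ := exists_cutIco_subset hV.isOpen hf
      exact ⟨(a, b), hab, fun _ => ⟨h1, h2⟩⟩
    -- Any nondegenerate interval serves here; it only keeps `hp` unconditional.
    · obtain ⟨a, b, -, hab, -, -⟩ := exists_cutIco_subset isOpen_univ (mem_univ f)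
      exact ⟨(a, b), hab, fun h => absurd h hf⟩
  choose p hp hpV using hcover
  obtain ⟨t, htV, ht⟩ := hV.isClosed.isCompact.elim_nhds_subcover
    (fun f => cutIco γ (p f).1 (p f).2)
    fun f hf => (isClopen_cutIco _ _ _).isOpen.mem_nhds (hpV f hf).1
  have hVt : V = ⋃ f ∈ t, cutIco γ (p f).1 (p f).2 :=
    subset_antisymm ht (iUnion₂_subset fun f hf => (hpV f (htV f hf)).2)
  rw [hVt]
  clear hVt ht htV
  induction t using Finset.induction_on with
  | empty => simpa using ⟨isClopen_empty, isDivisibleSet_empty _ _⟩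
  | insert g t _ ih =>
    rw [Finset.set_biUnion_insert]
    generalize (⋃ f ∈ t, cutIco γ (p f).1 (p f).2) = A at ih
    obtain ⟨hA, ih⟩ := ih
    refine ⟨(isClopen_cutIco _ _ _).union hA, fun c d => ?_⟩
    have hab := hp g
    generalize (p g).1 = a at *
    generalize (p g).2 = b at *
    -- Inside `[c, d)`, split into the part of `A` left of `a`, the new interval, and the part of
    -- `A` right of `b`. These are disjoint, and `ih` handles both traces of `A`.
    have heq : (cutIco γ a b ∪ A) ∩ cutIco γ c d =
        (A ∩ cutIco γ c (min d a)) ∪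
          (cutIco γ (max a c) (min b d) ∪ (A ∩ cutIco γ (max c b) d)) := by
      ext f
      have := mem_of_le f hab.le
      simp only [cutIco, mem_union, mem_inter_iff, mem_ofPred_eq, f.2.1.map_max, f.2.1.map_min]
      generalize f.1 a = fa, f.1 b = fb, f.1 c = fc, f.1 d = fd at *
      by_cases f ∈ A <;> cases fa <;> cases fb <;> cases fc <;> cases fd <;> simp_all
    rw [heq]
    have hcl := isClopen_cutIco γ
    refine (ih _ _).union ((isDivisibleSet_cutIco _ _ _).union (ih _ _) (hcl _ _) ?_)
      (hA.inter (hcl _ _)) ?_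
    all_goals
      refine Set.disjoint_left.2 fun f => ?_
      have := mem_of_le f hab.le
      simp only [cutIco, mem_union, mem_inter_iff, mem_ofPred_eq, f.2.1.map_max, f.2.1.map_min]
      generalize f.1 a = fa, f.1 b = fb, f.1 c = fc, f.1 d = fd at *
      cases fa <;> cases fb <;> cases fc <;> cases fd <;> simp_all

end Cut

/-! ### The integers compactified by the `2`-adic integers -/

/-- The closure of the diagonal copy of `ℤ` in the product of its one-point compactification and
`ℤ_[2]`. A point of the one-point compactification is coded by its indicator function. -/
def adicIntSet : Set ((ℤ → Bool) × ℤ_[2]) :=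
  {p | ∀ n : ℤ, p.1 n = true → p.1 = Pi.single n true ∧ p.2 = n}

lemma isClosed_adicIntSet : IsClosed adicIntSet := by
  have : adicIntSet = ⋂ n : ℤ, {p : (ℤ → Bool) × ℤ_[2] | p.1 n = false} ∪
      {p | p.1 = Pi.single n true ∧ p.2 = n} := by
    ext p
    simp only [adicIntSet, mem_iInter, mem_union, mem_ofPred_eq]
    refine forall_congr' fun n => ?_
    cases p.1 n <;> simp
  rw [this]
  refine isClosed_iInter fun n => (isClosed_eq ?_ continuous_const).union
    ((isClosed_eq continuous_fst continuous_const).inter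
      (isClosed_eq continuous_snd continuous_const))
  exact (continuous_apply n).comp continuous_fst

instance : CompactSpace adicIntSet :=
  isCompact_iff_compactSpace.1 isClosed_adicIntSet.isCompact

noncomputable instance : MeasurableSpace adicIntSet := borel _

instance : BorelSpace adicIntSet := ⟨rfl⟩

/-- The embedding of `ℤ` in its compactification. -/
noncomputable def adicInt (n : ℤ) : adicIntSet :=
  ⟨(Pi.single n true, n), fun m hm => by
    have : m = n := by
      by_contra h
      simp [h] at hm
    simp [this]⟩

/-- The integer point `n` as a set. -/
def adicIntFiber (n : ℤ) : Set adicIntSet := {p | p.1.1 n = true}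

lemma adicIntFiber_eq (n : ℤ) : adicIntFiber n = {adicInt n} := by
  ext p
  simp only [adicIntFiber, mem_ofPred_eq, mem_singleton_iff]
  constructor
  · intro h
    exact Subtype.ext (Prod.ext (p.2 n h).1 (p.2 n h).2)
  · rintro rfl
    simp [adicInt]

lemma isClopen_singleton_adicInt (n : ℤ) : IsClopen {adicInt n} := by
  rw [← adicIntFiber_eq]
  exact (isClopen_discrete {true}).preimage
    ((continuous_apply n).comp (continuous_fst.comp continuous_subtype_val))

lemma adicInt_injective : Function.Injective adicInt := by
  intro m n h
  have := congrArg (fun p : adicIntSet => p.1.2) h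
  simpa [adicInt] using this

/-- Every neighbourhood of a point at infinity contains infinitely many integers. -/
lemma infinite_adicInt_preimage {p : adicIntSet} (hp : p ∉ range adicInt) {U : Set adicIntSet}
    (hU : IsOpen U) (hpU : p ∈ U) : (adicInt ⁻¹' U).Infinite := by
  intro hfin
  obtain ⟨V, hV, rfl⟩ := isOpen_induced_iff.1 hU
  have hzero : p.1.1 = fun _ => false := by
    funext n
    by_contra h
    have hmem : p ∈ adicIntFiber n := by simpa [adicIntFiber] using h
    rw [adicIntFiber_eq] at hmem
    exact hp ⟨n, hmem.symm⟩
  obtain ⟨A, B, hA, hB, hpA, hpB, hAB⟩ := isOpen_prod_iff.1 hV p.1.1 p.1.2 hpU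
  obtain ⟨I, u, hu, hIA⟩ := isOpen_pi_iff.1 hA _ hpA
  have hdense : Dense (range (Int.cast : ℤ → ℤ_[2])) := PadicInt.denseRange_intCast
  -- `ℤ_[2]` has no isolated points, as `z + 2 ^ k` tends to `z`; hence the integers stay dense
  -- after finitely many are removed.
  have hne : ∀ z : ℤ_[2], Filter.NeBot (nhdsWithin z {z}ᶜ) := by
    intro z
    by_contra h
    rw [Filter.not_neBot, ← isOpen_singleton_iff_punctured_nhds] at h
    have hlim : Filter.Tendsto (fun k : ℕ => z + (2 : ℤ_[2]) ^ k) Filter.atTop (nhds z) := by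
      have h2 : ‖(2 : ℤ_[2])‖ < 1 := by
        have := PadicInt.norm_p (p := 2)
        push_cast at this
        rw [this]
        norm_num
      simpa using (tendsto_pow_atTop_nhds_zero_of_norm_lt_one h2).const_add z
    obtain ⟨k, hk⟩ := (hlim.eventually (h.mem_nhds (mem_singleton z))).exists
    exact pow_ne_zero k two_ne_zero (add_eq_left.1 (mem_singleton_iff.1 hk))
  obtain ⟨z, hzB, ⟨n, rfl⟩, hn⟩ := (hdense.sdiff_finite
    ((hfin.union I.finite_toSet).image (Int.cast : ℤ → ℤ_[2]))).inter_open_nonempty B hB ⟨_, hpB⟩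
  have hnot : n ∉ adicInt ⁻¹' (Subtype.val ⁻¹' V) ∪ (I : Set ℤ) := fun h => hn ⟨n, h, rfl⟩
  -- Since `n` is outside `I`, its indicator vanishes on `I`, as that of `p` does.
  refine hnot (Or.inl (hAB ⟨hIA fun m hm => ?_, hzB⟩))
  have hmn : m ≠ n := by
    rintro rfl
    exact hnot (Or.inr hm)
  have := (hu m hm).2
  rw [hzero] at this
  change (Pi.single n true : ℤ → Bool) m ∈ u m
  rw [Pi.single_eq_of_ne hmn]
  exact this

/-- The shift of the compactified integers. -/
noncomputable def adicShift : adicIntSet ≃ₜ adicIntSet where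
  toFun p := ⟨(fun n => p.1.1 (n - 1), p.1.2 + 1), fun n hn => by
    obtain ⟨h1, h2⟩ := p.2 _ hn
    refine ⟨funext fun m => ?_, ?_⟩
    · simp [h1, Pi.single_apply, sub_left_inj]
    · simp [h2]⟩
  invFun p := ⟨(fun n => p.1.1 (n + 1), p.1.2 - 1), fun n hn => by
    obtain ⟨h1, h2⟩ := p.2 _ hn
    refine ⟨funext fun m => ?_, ?_⟩
    · simp [h1, Pi.single_apply]
    · simp [h2]⟩
  left_inv p := by ext <;> simp
  right_inv p := by ext <;> simp
  continuous_toFun := by fun_prop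
  continuous_invFun := by fun_prop

lemma adicShift_adicInt (n : ℤ) : adicShift (adicInt n) = adicInt (n + 1) := by
  refine Subtype.ext (Prod.ext (funext fun m => ?_) ?_)
  · simp [adicShift, adicInt, Pi.single_apply, sub_eq_iff_eq_add]
  · simp [adicShift, adicInt]

/-! ### The product of the compactified integers with a finite measure space -/

section Sum

variable {K : Type*} [MeasurableSpace K]

/-- The slice of `V` at the integer `n`. -/
def slice (V : Set (adicIntSet × K)) (n : ℤ) : Set K := Prod.mk (adicInt n) ⁻¹' V

/-- The product of the counting measure on `ℤ` with `ν`. -/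
noncomputable def sumMeasure (ν : Measure K) : Measure (adicIntSet × K) :=
  Measure.sum fun n : ℤ => ν.map (Prod.mk (adicInt n))

variable {ν : Measure K}

lemma sumMeasure_apply {V : Set (adicIntSet × K)} (hV : MeasurableSet V) :
    sumMeasure ν V = ∑' n, ν (slice V n) := by
  rw [sumMeasure, Measure.sum_apply _ hV]
  exact tsum_congr fun n => Measure.map_apply measurable_prodMk_left hV

lemma sumMeasure_univ (hν : ν univ ≠ 0) : sumMeasure ν univ = ⊤ := by
  rw [sumMeasure_apply MeasurableSet.univ]
  exact ENNReal.tsum_const_eq_top_of_ne_zero hν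

end Sum

section Product

variable {K : Type*} [TopologicalSpace K]

/-- The shift on the first factor. -/
noncomputable def shiftProd (K : Type*) [TopologicalSpace K] : adicIntSet × K ≃ₜ adicIntSet × K :=
  adicShift.prodCongr (Homeomorph.refl K)

/-- Each step adds `1` to the 2-adic coordinate, and `ℤ_[2]` has characteristic zero. -/
lemma isAperiodic_shiftProd : IsAperiodic (shiftProd K) := by
  intro x n hn h
  have key : ∀ m : ℕ, ((shiftProd K)^[m] x).1.1.2 = x.1.1.2 + m := by
    intro m
    induction m with
    | zero => simp
    | succ m ih =>
      rw [Function.iterate_succ_apply', Nat.cast_succ, ← add_assoc, ← ih]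
      rfl
  have := key n
  rw [h] at this
  simp [hn.ne'] at this

lemma IsClopen.slice {V : Set (adicIntSet × K)} (hV : IsClopen V) (n : ℤ) :
    IsClopen (slice V n) := hV.preimage (by fun_prop)

/-- The set of points whose first coordinate is an integer of `s`. -/
def integerPart (K : Type*) (s : Finset ℤ) : Set (adicIntSet × K) := (adicInt '' s) ×ˢ univ

lemma isClopen_integerPart (s : Finset ℤ) : IsClopen (integerPart K s) := by
  refine IsClopen.prod ?_ isClopen_univ
  have : adicInt '' s = ⋃ n ∈ s, {adicInt n} := by
    ext p; simp [eq_comm]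
  rw [this]
  exact isClopen_biUnion_finset fun n _ => isClopen_singleton_adicInt n

variable [MeasurableSpace K] [BorelSpace K] [SecondCountableTopology K] {ν : Measure K}

lemma sumMeasure_integerPart_inter {V : Set (adicIntSet × K)} (hV : IsClopen V)
    (s : Finset ℤ) : sumMeasure ν (integerPart K s ∩ V) = ∑ n ∈ s, ν (slice V n) := by
  rw [sumMeasure_apply ((isClopen_integerPart s).inter hV).isOpen.measurableSet]
  rw [tsum_eq_sum (s := s)]
  · refine Finset.sum_congr rfl fun n hn => ?_
    congr 1
    ext k
    simp [slice, integerPart, adicInt_injective.eq_iff, hn]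
  · intro n hn
    have : slice (integerPart K s ∩ V) n = ∅ := by
      ext k
      simp [slice, integerPart, adicInt_injective.eq_iff, hn]
    simp [this]

lemma measurePreserving_shiftProd :
    MeasurePreserving (shiftProd K) (sumMeasure ν) (sumMeasure ν) := by
  have hm : Measurable (shiftProd K) := (shiftProd K).continuous.measurable
  refine ⟨hm, Measure.ext fun V hV => ?_⟩
  rw [Measure.map_apply hm hV, sumMeasure_apply (hm hV), sumMeasure_apply hV,
    ← (Equiv.addRight (1 : ℤ)).tsum_eq fun n => ν (slice V n)]
  refine tsum_congr fun n => ?_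
  congr 1
  ext k
  simp [slice, shiftProd, adicShift_adicInt]

/-- Clopen sets of finite measure stay away from infinity. -/
lemma exists_subset_integerPart [CompactSpace K]
    (hfull : ∀ U : Set K, IsOpen U → U.Nonempty → 0 < ν U)
    {U : Set (adicIntSet × K)} (hU : IsClopen U) (hfin : sumMeasure ν U < ⊤) :
    ∃ s : Finset ℤ, U ⊆ integerPart K s := by
  have hsub : U ⊆ ⋃ n : ℤ, integerPart K {n} := by
    rintro ⟨p, k⟩ hpk
    by_contra h
    have hp : p ∉ range adicInt := by
      rintro ⟨n, rfl⟩
      exact h (mem_iUnion.2 ⟨n, by simp [integerPart]⟩)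
    obtain ⟨A, B, hA, hB, hpA, hkB, hAB⟩ := isOpen_prod_iff.1 hU.isOpen p k hpk
    have hinf := infinite_adicInt_preimage hp hA hpA
    -- A box `A ×ˢ B` around a point at infinity puts `B`, of positive measure, into infinitely many
    -- slices of `U`.
    refine hfin.ne (top_le_iff.1 ?_)
    have : Infinite (adicInt ⁻¹' A) := hinf.to_subtype
    calc (⊤ : ENNReal) = ∑' _ : adicInt ⁻¹' A, ν B :=
          (ENNReal.tsum_const_eq_top_of_ne_zero (hfull B hB ⟨k, hkB⟩).ne').symm
      _ ≤ ∑' n : adicInt ⁻¹' A, ν (slice U n) :=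
          ENNReal.tsum_le_tsum fun n => measure_mono fun b hb => hAB ⟨n.2, hb⟩
      _ ≤ ∑' n, ν (slice U n) := ENNReal.tsum_comp_le_tsum_of_injective
          Subtype.val_injective fun n => ν (slice U n)
      _ = sumMeasure ν U := (sumMeasure_apply hU.isOpen.measurableSet).symm
  obtain ⟨s, hs⟩ := hU.isClosed.isCompact.elim_finite_subcover _
    (fun n => (isClopen_integerPart {n}).isOpen) hsub
  refine ⟨s, hs.trans (iUnion₂_subset fun n hn => ?_)⟩
  exact prod_mono (image_mono (by simpa using hn)) subset_rfl

variable {G : AddSubgroup ℝ}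

lemma isDivisibleSet_integerPart_inter
    (hdiv : ∀ V : Set K, IsClopen V → IsDivisibleSet ν G V)
    {V : Set (adicIntSet × K)} (hV : IsClopen V) (s : Finset ℤ) :
    IsDivisibleSet (sumMeasure ν) G (integerPart K s ∩ V) := by
  induction s using Finset.induction_on with
  | empty => simpa [integerPart] using isDivisibleSet_empty _ _
  | insert n s hn ih =>
    have heq : integerPart K (insert n s) ∩ V =
        (integerPart K {n} ∩ V) ∪ (integerPart K s ∩ V) := by
      rw [← union_inter_distrib_right]
      rw [integerPart, Finset.coe_insert, insert_eq, image_union, union_prod]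
      simp [integerPart]
    have hdisj : Disjoint (integerPart K {n} ∩ V) (integerPart K s ∩ V) := by
      refine Disjoint.mono inter_subset_left inter_subset_left (Set.disjoint_left.2 ?_)
      rintro ⟨p, k⟩ hp hp'
      simp only [integerPart, mem_prod, mem_image, Finset.mem_coe, Finset.mem_singleton] at hp hp'
      obtain ⟨⟨m, rfl, hm⟩, -⟩ := hp
      obtain ⟨⟨l, hl, hl'⟩, -⟩ := hp'
      rw [← hm, adicInt_injective.eq_iff] at hl'
      exact hn (hl' ▸ hl)
    rw [heq]
    refine IsDivisibleSet.union ?_ ih ((isClopen_integerPart _).inter hV) hdisj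
    obtain ⟨e, heG, he0, hμ, h⟩ := hdiv _ (hV.slice n)
    refine ⟨e, heG, he0, ?_, fun d hd hd0 hde => ?_⟩
    · rw [sumMeasure_integerPart_inter hV]
      simpa using hμ
    · obtain ⟨W, hWV, hW, hμW⟩ := h d hd hd0 hde
      have hW' : IsClopen (univ ×ˢ W : Set (adicIntSet × K)) := isClopen_univ.prod hW
      refine ⟨integerPart K {n} ∩ univ ×ˢ W, ?_, (isClopen_integerPart _).inter hW', ?_⟩
      · rintro ⟨p, k⟩ ⟨hp, hk⟩
        refine ⟨hp, ?_⟩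
        simp only [integerPart, mem_prod, mem_image, Finset.mem_coe, Finset.mem_singleton] at hp
        obtain ⟨⟨m, rfl, rfl⟩, -⟩ := hp
        exact hWV hk.2
      · rw [sumMeasure_integerPart_inter hW', Finset.sum_singleton, ← hμW]
        congr 1
        ext k
        simp [slice]

/-- Elements of `G` below the measure of a clopen set are measures of clopen subsets. -/
lemma exists_isClopen_subset_sumMeasure_eq
    (hdiv : ∀ V : Set K, IsClopen V → IsDivisibleSet ν G V)
    {V : Set (adicIntSet × K)} (hV : IsClopen V) {d : ℝ} (hd : d ∈ G) (hd0 : 0 ≤ d)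
    (hdV : ENNReal.ofReal d < sumMeasure ν V) :
    ∃ W : Set (adicIntSet × K), IsClopen W ∧ W ⊆ V ∧ sumMeasure ν W = ENNReal.ofReal d := by
  -- `V` may have infinite measure, but some finite partial sum of its slices already exceeds `d`.
  rw [sumMeasure_apply hV.isOpen.measurableSet, ENNReal.tsum_eq_iSup_sum, lt_iSup_iff] at hdV
  obtain ⟨s, hs⟩ := hdV
  rw [← sumMeasure_integerPart_inter hV] at hs
  obtain ⟨e, -, -, he, h⟩ := isDivisibleSet_integerPart_inter hdiv hV s
  rw [he] at hs
  obtain ⟨W, hWV, hW, hμW⟩ := h d hd hd0 (ENNReal.ofReal_lt_ofReal_iff'.1 hs).1.le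
  exact ⟨W, hW, hWV.trans inter_subset_right, hμW⟩

lemma isNonDefective_sumMeasure [T1Space K] [IsFiniteMeasure ν]
    (hfull : ∀ U : Set K, IsOpen U → U.Nonempty → 0 < ν U) (hna : ∀ k : K, ν {k} = 0)
    (hν : ν univ ≠ 0) : IsNonDefective (sumMeasure ν) where
  full U hU hne := by
    obtain ⟨⟨p, k⟩, hpk⟩ := hne
    obtain ⟨A, B, hA, hB, hpA, hkB, hAB⟩ := isOpen_prod_iff.1 hU p k hpk
    obtain ⟨n, hn⟩ : ∃ n, adicInt n ∈ A := by
      by_cases hp : p ∈ range adicInt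
      · obtain ⟨n, rfl⟩ := hp
        exact ⟨n, hpA⟩
      · exact (infinite_adicInt_preimage hp hA hpA).nonempty
    rw [sumMeasure_apply hU.measurableSet]
    refine (hfull B hB ⟨k, hkB⟩).trans_le (le_trans ?_ (ENNReal.le_tsum n))
    exact measure_mono fun b hb => hAB ⟨hn, hb⟩
  nonatomic x := by
    rw [sumMeasure_apply (measurableSet_singleton x), ENNReal.tsum_eq_zero]
    refine fun n => measure_mono_null (fun k hk => ?_) (hna x.2)
    exact congrArg Prod.snd (show (adicInt n, k) = x from hk)
  infinite := sumMeasure_univ hν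
  null_defectiveSet := by
    -- Each copy of `K` over an integer is a clopen set of finite measure, so defective points lie
    -- over the added `ℤ_[2]`, which meets no integer slice.
    refine measure_mono_null (t := ⋂ n : ℤ, (integerPart K {n})ᶜ) ?_ ?_
    · intro x hx
      refine mem_iInter.2 fun n hn => ?_
      have h := hx _ (isClopen_integerPart {n}) hn
      have h' := sumMeasure_integerPart_inter (ν := ν) isClopen_univ {n}
      rw [inter_univ, h, Finset.sum_singleton] at h'
      exact measure_ne_top _ _ h'.symm
    · rw [sumMeasure_apply (MeasurableSet.iInter fun n =>
        (isClopen_integerPart {n}).isOpen.measurableSet.compl), ENNReal.tsum_eq_zero]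
      intro n
      have : slice (⋂ n : ℤ, (integerPart K {n})ᶜ) n = ∅ := by
        ext k
        simp only [slice, mem_preimage, mem_iInter, mem_empty_iff_false, iff_false]
        exact fun h => h n (by simp [integerPart])
      simp [this]

variable [CompactSpace K]

/-- Finite measures of clopen sets lie in `G`. -/
lemma exists_sumMeasure_eq (hfull : ∀ U : Set K, IsOpen U → U.Nonempty → 0 < ν U)
    (hdiv : ∀ V : Set K, IsClopen V → IsDivisibleSet ν G V)
    {U : Set (adicIntSet × K)} (hU : IsClopen U) (hfin : sumMeasure ν U < ⊤) :
    ∃ e ∈ G, 0 ≤ e ∧ sumMeasure ν U = ENNReal.ofReal e := by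
  obtain ⟨s, hs⟩ := exists_subset_integerPart hfull hU hfin
  obtain ⟨e, heG, he0, he, -⟩ := isDivisibleSet_integerPart_inter hdiv hU s
  rw [inter_eq_right.2 hs] at he
  exact ⟨e, heG, he0, he⟩

lemma isGoodMeasure_sumMeasure (hfull : ∀ U : Set K, IsOpen U → U.Nonempty → 0 < ν U)
    (hdiv : ∀ V : Set K, IsClopen V → IsDivisibleSet ν G V) :
    IsGoodMeasure (sumMeasure ν) := by
  intro V hV U hU hUV
  obtain ⟨e, heG, he0, he⟩ := exists_sumMeasure_eq hfull hdiv hU (hUV.trans_le le_top)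
  rw [he] at hUV ⊢
  exact exists_isClopen_subset_sumMeasure_eq hdiv hV heG he0 hUV

lemma clopenValues_sumMeasure (hfull : ∀ U : Set K, IsOpen U → U.Nonempty → 0 < ν U)
    (hdiv : ∀ V : Set K, IsClopen V → IsDivisibleSet ν G V) (hν : ν univ ≠ 0) :
    clopenValues (sumMeasure ν) = {x | x ∈ G ∧ 0 ≤ x} := by
  ext r
  constructor
  · rintro ⟨U, hU, hfin, rfl⟩
    obtain ⟨e, heG, he0, he⟩ := exists_sumMeasure_eq hfull hdiv hU hfin
    rw [he, ENNReal.toReal_ofReal he0]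
    exact ⟨heG, he0⟩
  · rintro ⟨hr, hr0⟩
    obtain ⟨W, hW, -, hμ⟩ := exists_isClopen_subset_sumMeasure_eq hdiv isClopen_univ hr hr0
      (by rw [sumMeasure_univ hν]; exact ENNReal.ofReal_lt_top)
    exact ⟨W, hW, by rw [hμ]; exact ENNReal.ofReal_lt_top, by rw [hμ, ENNReal.toReal_ofReal hr0]⟩

end Product

theorem mainTheorem5 (D : Set ℝ) (hcount : D.Countable) (hgroup : IsGroupLike D)
    (hdense : Set.Ici (0 : ℝ) ⊆ closure D) :
    ∃ (X : Type) (_ : TopologicalSpace X) (_ : MeasurableSpace X) (_ : BorelSpace X)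
      (T : X ≃ₜ X) (μ : MeasureTheory.Measure X),
      IsCantorSpace X ∧ IsAperiodic T ∧ IsNonDefective μ ∧ IsGoodMeasure μ ∧
        MeasureTheory.MeasurePreserving T μ μ ∧ clopenValues μ = D := by
  have hD : ∀ a b : ℝ, 0 ≤ a → a < b → ∃ g ∈ D, g ∈ Ioo a b := fun a b =>
    exists_mem_Ioo_of_Ici_subset_closure hdense
  obtain ⟨G, rfl⟩ := hgroup.exists_addSubgroup fun a => by
    obtain ⟨g, hg, h⟩ := hD (max a 0) (max a 0 + 1) (le_max_right _ _) (by linarith)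
    exact ⟨g, hg, (le_max_left a 0).trans_lt h.1⟩
  have hG : ∀ a b : ℝ, 0 ≤ a → a < b → ∃ g ∈ G, g ∈ Ioo a b := fun a b ha hab =>
    let ⟨g, hg, h⟩ := hD a b ha hab
    ⟨g, hg.1, h⟩
  have : Countable G := by
    have h : (G : Set ℝ) ⊆ {x | x ∈ G ∧ 0 ≤ x} ∪ Neg.neg '' {x | x ∈ G ∧ 0 ≤ x} := by
      intro x hx
      rcases le_total 0 x with h0 | h0
      · exact Or.inl ⟨hx, h0⟩
      · exact Or.inr ⟨-x, ⟨G.neg_mem hx, by linarith⟩, neg_neg x⟩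
    exact ((hcount.union (hcount.image _)).mono h).to_subtype
  -- Any positive element of `G` would do as the length of `K`.
  obtain ⟨c, hc, hc0, -⟩ := hG 0 1 le_rfl one_pos
  have hfull : ∀ U : Set (cutSet (⟨c, hc⟩ : G)), IsOpen U → U.Nonempty → 0 < cutMeasure _ U :=
    fun _ => cutMeasure_pos
  have hdiv : ∀ V : Set (cutSet (⟨c, hc⟩ : G)), IsClopen V → IsDivisibleSet (cutMeasure _) G V :=
    fun _ => isDivisibleSet_cutMeasure
  have huniv := cutMeasure_univ (⟨c, hc⟩ : G)
  have hν : cutMeasure (⟨c, hc⟩ : G) univ ≠ 0 := by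
    rw [huniv]
    exact (ENNReal.ofReal_pos.2 hc0).ne'
  have : IsFiniteMeasure (cutMeasure (⟨c, hc⟩ : G)) := ⟨by rw [huniv]; exact ENNReal.ofReal_lt_top⟩
  have hnd := isNonDefective_sumMeasure hfull (cutMeasure_singleton hG) hν
  refine ⟨adicIntSet × cutSet (⟨c, hc⟩ : G), inferInstance, inferInstance, inferInstance,
    shiftProd _, sumMeasure (cutMeasure _), ⟨?_, inferInstance, inferInstance,
      perfectSpace_of_full_of_nonatomic hnd.full hnd.nonatomic,
      loc_compact_Haus_tot_disc_of_zero_dim⟩, isAperiodic_shiftProd, hnd,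
    isGoodMeasure_sumMeasure hfull hdiv, measurePreserving_shiftProd,
    clopenValues_sumMeasure hfull hdiv hν⟩
  by_contra h
  rw [not_nonempty_iff] at h
  simpa [univ_eq_empty_iff.2 h] using hnd.infinite
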